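/- Let $n\ge 2$ and let $\Omega\subset\mathbb R^n$ be a bounded domain with Lipschitz boundary. Then there is a constant $C_P>0$ such that the Poincaré inequality $$\int_\Omega |w|\,dx\le C_P\int_\Omega\|\nabla w\|\,dx\qquad\text{for all } w\in W^{1,1}_0(\Omega) \tag{P}$$ holds, where $W^{1,1}_0(\Omega)$ is the closure of $C_c^\infty(\Omega)$ in $W^{1,1}(\Omega)$. Let $0<B\le\infty$, let $h:(0,B)\to(0,\infty)$ be continuous, and let $H,\widetilde H:(0,B)\to\mathbb R$ satisfy $H'=h$ and $\widetilde H'=H$ on $(0,B)$. Let $I$ be the largest among the intervals $(0,B)$, $[0,B)$, $(0,B]$, $[0,B]$ (the last two being allowed only if $B<\infty$) to which $\widetilde H$ extends continuously; denote the extension again by $\widetilde H$. Put $$\mathcal T_H(s)=\frac{H(s)}{h(s)},\qquad \mathcal G_H(s)=\frac{H(s)^2}{h(s)},\qquad s\in(0,B),$$ and assume that there is a constant $C_{\widetilde H}>0$ with $\mathcal G_H(s)\le C_{\widetilde H}|\widetilde H(s)|$ for all $s\in(0,B)$. Let $u\in W^{1,1}_{\rm loc}(\Omega)$ satisfy $u(x)\in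 I$ for a.e. $x\in\Omega$ and $\widetilde H(u)\in W^{1,1}_0(\Omega)$. Then, for every constant $C_P>0$ for which (P) holds, $$\int_{\Omega\cap\{u\in(0,B)\}}\mathcal G_H(u)\,dx=\int_{\Omega\cap\{u\in(0,B)\}}|\mathcal T_H(u)|^2h(u)\,dx\le C_PC_{\widetilde H}\int_{\Omega\cap\{u\in(0,B)\}}\|\nabla u\|\,|\mathcal T_H(u)|\,h(u)\,dx,$$ $$\int_{\Omega\cap\{u\in(0,B)\}}\|\nabla u\|\,|\mathcal T_H(u)|\,h(u)\,dx\le C_PC_{\widetilde H}\int_{\Omega\cap\{u\in(0,B)\}}\|\nabla u\|^2h(u)\,dx,$$ where the last integral may be infinite. Moreover, all integrals in the first line are finite. -/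

import Mathlib

open MeasureTheory
open scoped ContDiff

namespace OpialIneq

/-- The boundary of `Ω` is Lipschitz: near each boundary point, in suitable Cartesian coordinates
(vertical direction `ν`, horizontal part `y - ⟪ν, y⟫ ν`), `Ω` is the set of points strictly below
the graph of a Lipschitz function of the horizontal part. -/
def HasLipschitzBoundary {n : ℕ} (Ω : Set (EuclideanSpace ℝ (Fin n))) : Prop :=
  ∀ x ∈ frontier Ω, ∃ (r : ℝ) (ν : EuclideanSpace ℝ (Fin n)) (K : NNReal)
    (Φ : EuclideanSpace ℝ (Fin n) → ℝ), 0 < r ∧ ‖ν‖ = 1 ∧ LipschitzWith K Φ ∧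
      ∀ y ∈ Metric.ball x r, (y ∈ Ω ↔ inner ℝ ν y < Φ (y - inner ℝ ν y • ν))

/-- A bounded domain with Lipschitz boundary in `ℝⁿ`. -/
structure IsBoundedLipschitzDomain {n : ℕ} (Ω : Set (EuclideanSpace ℝ (Fin n))) : Prop where
  isOpen : IsOpen Ω
  isConnected : IsConnected Ω
  isBounded : Bornology.IsBounded Ω
  lipschitz : HasLipschitzBoundary Ω

/-- `φ ∈ C_c^∞(Ω)`. -/
structure IsTestFunction {n : ℕ} (Ω : Set (EuclideanSpace ℝ (Fin n)))
    (φ : EuclideanSpace ℝ (Fin n) → ℝ) : Prop where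
  smooth : ContDiff ℝ ∞ φ
  compact : HasCompactSupport φ
  subset : tsupport φ ⊆ Ω

/-- `u ∈ W^{1,1}_loc(Ω)` with weak gradient `∇u = Du` (a representative of it). -/
structure HasWeakGradient {n : ℕ} (Ω : Set (EuclideanSpace ℝ (Fin n)))
    (u : EuclideanSpace ℝ (Fin n) → ℝ)
    (Du : EuclideanSpace ℝ (Fin n) → EuclideanSpace ℝ (Fin n)) : Prop where
  locallyIntegrable : LocallyIntegrableOn u Ω
  locallyIntegrable_grad : LocallyIntegrableOn Du Ω
  integral_eq : ∀ φ, IsTestFunction Ω φ → ∀ i : Fin n,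
    ∫ x in Ω, u x * fderiv ℝ φ x (EuclideanSpace.single i 1) = -∫ x in Ω, Du x i * φ x

/-- `w ∈ W_0^{1,1}(Ω)`: `w ∈ W^{1,1}(Ω)` and `w` is a limit of functions in `C_c^∞(Ω)` in the norm
of `W^{1,1}(Ω)`. -/
def MemW01 {n : ℕ} (Ω : Set (EuclideanSpace ℝ (Fin n)))
    (w : EuclideanSpace ℝ (Fin n) → ℝ) : Prop :=
  ∃ Dw : EuclideanSpace ℝ (Fin n) → EuclideanSpace ℝ (Fin n),
    HasWeakGradient Ω w Dw ∧ IntegrableOn w Ω ∧ IntegrableOn Dw Ω ∧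
    ∀ ε > 0, ∃ φ, IsTestFunction Ω φ ∧
      (∫ x in Ω, |w x - φ x|) + (∫ x in Ω, ‖Dw x - gradient φ x‖) < ε

/-- `C` is a constant in the Poincaré inequality on `W_0^{1,1}(Ω)`. -/
def IsPoincareConstant {n : ℕ} (Ω : Set (EuclideanSpace ℝ (Fin n))) (C : ℝ) : Prop :=
  0 < C ∧ ∀ w Dw, MemW01 Ω w → HasWeakGradient Ω w Dw →
    ∫ x in Ω, |w x| ≤ C * ∫ x in Ω, ‖Dw x‖

/-- The interval `(0, B)`, where `B` may be `∞`. -/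
def openInterval (B : EReal) : Set ℝ := {s | 0 < s ∧ (s : EReal) < B}

/-- The real points of `[0, B]`. -/
def closedInterval (B : EReal) : Set ℝ := {s | 0 ≤ s ∧ (s : EReal) ≤ B}

/-- `h` is a principal weight on `(0, B)`. -/
structure IsPrincipalWeight (B : EReal) (h : ℝ → ℝ) : Prop where
  continuousOn : ContinuousOn h (openInterval B)
  pos : ∀ s ∈ openInterval B, 0 < h s

/-- `I` is one of `(0,B)`, `[0,B)`, `(0,B]`, `[0,B]` (as a set of real numbers, so that it does not
contain `B` if `B = ∞`), `H' = h` and `Ht' = H` on `(0,B)`, `Ht` is continuous on `I`, and `I` is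
the largest such interval to which the restriction of `Ht` to `(0,B)` extends continuously. -/
structure IsAdmissibleInterval (B : EReal) (h H Ht : ℝ → ℝ) (I : Set ℝ) : Prop where
  openInterval_subset : openInterval B ⊆ I
  subset_closedInterval : I ⊆ closedInterval B
  hasDerivAt : ∀ s ∈ openInterval B, HasDerivAt H (h s) s
  hasDerivAt_tilde : ∀ s ∈ openInterval B, HasDerivAt Ht (H s) s
  continuousOn : ContinuousOn Ht I
  maximal : ∀ J : Set ℝ, openInterval B ⊆ J → J ⊆ closedInterval B →
    (∃ F : ℝ → ℝ, ContinuousOn F J ∧ ∀ s ∈ openInterval B, F s = Ht s) → J ⊆ I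

/-- The transform `T_H = H / h`. -/
noncomputable def transT (H h : ℝ → ℝ) (s : ℝ) : ℝ := H s / h s

/-- The transform `G_H = H² / h`. -/
noncomputable def transG (H h : ℝ → ℝ) (s : ℝ) : ℝ := H s ^ 2 / h s

end OpialIneq

/-! Put v = H̃(u). Where u lies in (0,B), the weak gradient of v is H(u)∇u, of norm ‖∇u‖ |T_H(u)|
h(u); elsewhere it vanishes. So the middle integral is exactly ∫_Ω ‖∇v‖, and the first inequality is
G_H ≤ C|H̃| integrated, combined with (P) for v. For the second, take c = C_P C: Young's inequality
bounds 2‖∇u‖ |H(u)| by c‖∇u‖² h(u) + c⁻¹ G_H(u), and by the first inequality the last term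
integrates to at most the finite middle integral, which is absorbed on the left.

The real work is the gradient formula (`ae_weakGradient_comp_eq`), since H̃ need not be C¹ up to the
endpoints. On {u ∈ [a,b]} with [a,b] ⊂ (0,B), v agrees with f(u) for a C¹ extension f of H̃ with
bounded derivative. The chain rule `HasWeakGradient.comp`, proved by mollification, covers f(u), and
functions that agree on a set have a.e. equal weak gradients there (`HasWeakGradient.ae_eq_of_eq`).
Countably many rational [a,b] exhaust (0,B), and at an endpoint value of u the function v is
constant. -/

namespace OpialIneq

open Filter Topology ContinuousLinearMap
open scoped Convolution

/-! ### L¹ convergence of mollifications. -/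

section Mollification

variable {E : Type*} [NormedAddCommGroup E] [InnerProductSpace ℝ E] [FiniteDimensional ℝ E]
  [MeasurableSpace E] [BorelSpace E] {μ : Measure E} [μ.IsAddHaarMeasure]

/-- The kernel is nonnegative with integral one, so |φ ⋆ g| ≤ φ ⋆ |g|, and the right side has the
same integral as |g|. -/
theorem integral_abs_normed_convolution_le (φ : ContDiffBump (0 : E)) {g : E → ℝ}
    (hg : Integrable g μ) :
    ∫ x, |(φ.normed μ ⋆[lsmul ℝ ℝ, μ] g) x| ∂μ ≤ ∫ x, |g x| ∂μ := by
  have h1 : ∫ x, (φ.normed μ ⋆[lsmul ℝ ℝ, μ] fun y => |g y|) x ∂μ = ∫ x, |g x| ∂μ := by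
    rw [integral_convolution _ φ.integrable_normed hg.abs, φ.integral_normed]
    simp
  rw [← h1]
  refine integral_mono (φ.integrable_normed.integrable_convolution _ hg).abs
    (φ.integrable_normed.integrable_convolution _ hg.abs) fun x => ?_
  refine (abs_integral_le_integral_abs).trans_eq (integral_congr_ae (ae_of_all _ fun t => ?_))
  simp [abs_mul, abs_of_nonneg (φ.nonneg_normed t)]

/-- Uniform continuity makes the convergence uniform, and for radii below 1 the difference lives on
one compact set of finite measure. -/
theorem tendsto_integral_abs_normed_convolution_sub_of_continuous {φ : ℕ → ContDiffBump (0 : E)}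
    (hφ : Tendsto (fun k => (φ k).rOut) atTop (𝓝 0)) {g : E → ℝ} (hg : Continuous g)
    (hc : HasCompactSupport g) :
    Tendsto (fun k => ∫ x, |((φ k).normed μ ⋆[lsmul ℝ ℝ, μ] g) x - g x| ∂μ) atTop (𝓝 0) := by
  set K := Metric.cthickening 1 (tsupport g)
  have hK : IsCompact K := hc.isCompact.cthickening
  have hgi : Integrable g μ := hg.integrable_of_hasCompactSupport hc
  have hconv : ∀ k, Integrable ((φ k).normed μ ⋆[lsmul ℝ ℝ, μ] g) μ := fun k =>
    (φ k).integrable_normed.integrable_convolution _ hgi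
  rw [Metric.tendsto_atTop]
  intro ε hε
  set M := μ.real K
  have hM : 0 ≤ M := measureReal_nonneg
  -- Dividing by M + 1 rather than M allows M = 0.
  obtain ⟨δ, hδ, hδg⟩ := Metric.uniformContinuous_iff.1
    (hc.uniformContinuous_of_continuous hg) (ε / (2 * (M + 1))) (by positivity)
  obtain ⟨N, hN⟩ := (Metric.tendsto_atTop.1 hφ) (min δ 1) (by positivity)
  refine ⟨N, fun k hk => ?_⟩
  have hr : (φ k).rOut < min δ 1 := by
    have := hN k hk
    rwa [Real.dist_eq, sub_zero, abs_of_pos (φ k).rOut_pos] at this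
  have hpt : ∀ x, |((φ k).normed μ ⋆[lsmul ℝ ℝ, μ] g) x - g x| ≤
      K.indicator (fun _ => ε / (2 * (M + 1))) x := by
    intro x
    rw [← Real.dist_eq]
    refine (φ k).dist_normed_convolution_le hg.aestronglyMeasurable fun y hy => ?_
    rw [Metric.mem_ball] at hy
    by_cases hx : x ∈ K
    · rw [Set.indicator_of_mem hx]
      exact (hδg (hy.trans (hr.trans_le (min_le_left _ _)))).le
    · rw [Set.indicator_of_notMem hx]
      have hz : ∀ z, dist z x ≤ 1 → g z = 0 := by
        intro z hz
        by_contra hne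
        exact hx (Metric.mem_cthickening_of_dist_le x z 1 _
          (subset_tsupport g (Function.mem_support.2 hne)) (by rwa [dist_comm]))
      rw [hz y (hy.le.trans (hr.le.trans (min_le_right _ _))), hz x (by simp)]
      simp
  have hle : ∫ x, |((φ k).normed μ ⋆[lsmul ℝ ℝ, μ] g) x - g x| ∂μ ≤ M * (ε / (2 * (M + 1))) := by
    refine (integral_mono ((hconv k).sub hgi).abs
      ((integrable_indicator_iff hK.measurableSet).2
        (integrableOn_const hK.measure_lt_top.ne)) hpt).trans_eq ?_
    rw [integral_indicator hK.measurableSet, setIntegral_const, smul_eq_mul]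
  rw [Real.dist_eq, sub_zero, abs_of_nonneg (integral_nonneg fun x => abs_nonneg _)]
  refine hle.trans_lt ?_
  rw [mul_div_assoc', div_lt_iff₀ (by positivity)]
  nlinarith

/-- Density of C_c in L¹: the contraction bound controls the mollified error g - f uniformly in k.
-/
theorem tendsto_integral_abs_normed_convolution_sub {φ : ℕ → ContDiffBump (0 : E)}
    (hφ : Tendsto (fun k => (φ k).rOut) atTop (𝓝 0)) {g : E → ℝ} (hg : Integrable g μ) :
    Tendsto (fun k => ∫ x, |((φ k).normed μ ⋆[lsmul ℝ ℝ, μ] g) x - g x| ∂μ) atTop (𝓝 0) := by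
  rw [Metric.tendsto_atTop]
  intro ε hε
  obtain ⟨f, hfc, hfg, hf, hfi⟩ :=
    hg.exists_hasCompactSupport_integral_sub_le (show 0 < ε / 4 by positivity)
  obtain ⟨N, hN⟩ := Metric.tendsto_atTop.1
    (tendsto_integral_abs_normed_convolution_sub_of_continuous (μ := μ) hφ hf hfc) (ε / 4)
    (by positivity)
  refine ⟨N, fun k hk => ?_⟩
  have h2 := hN k hk
  rw [Real.dist_eq, sub_zero, abs_of_nonneg (integral_nonneg fun x => abs_nonneg _)] at h2 ⊢
  have hd : Integrable (g - f) μ := hg.sub hfi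
  have h1 := (integral_abs_normed_convolution_le (φ k) hd)
  have i1 := ((φ k).integrable_normed (μ := μ)).integrable_convolution (lsmul ℝ ℝ) hd
  have i2 := ((φ k).integrable_normed (μ := μ)).integrable_convolution (lsmul ℝ ℝ) hfi
  have i3 := ((φ k).integrable_normed (μ := μ)).integrable_convolution (lsmul ℝ ℝ) hg
  have hsub : ∀ᵐ x ∂μ, ((φ k).normed μ ⋆[lsmul ℝ ℝ, μ] g) x =
      ((φ k).normed μ ⋆[lsmul ℝ ℝ, μ] (g - f)) x + ((φ k).normed μ ⋆[lsmul ℝ ℝ, μ] f) x := by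
    filter_upwards [((φ k).integrable_normed (μ := μ)).ae_convolution_exists (lsmul ℝ ℝ) hd,
      ((φ k).integrable_normed (μ := μ)).ae_convolution_exists (lsmul ℝ ℝ) hfi] with x hx hx'
    rw [← hx.distrib_add hx', sub_add_cancel]
  have hle : ∫ x, |((φ k).normed μ ⋆[lsmul ℝ ℝ, μ] g) x - g x| ∂μ ≤
      ∫ x, (|((φ k).normed μ ⋆[lsmul ℝ ℝ, μ] (g - f)) x| +
        |((φ k).normed μ ⋆[lsmul ℝ ℝ, μ] f) x - f x| + |(g - f) x|) ∂μ := by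
    refine integral_mono_ae (i3.sub hg).abs ((i1.abs.add (i2.sub hfi).abs).add hd.abs) ?_
    filter_upwards [hsub] with x hx
    rw [hx]
    set a := ((φ k).normed μ ⋆[lsmul ℝ ℝ, μ] (g - f)) x
    set b := ((φ k).normed μ ⋆[lsmul ℝ ℝ, μ] f) x
    calc |a + b - g x| = |a + (b - f x) + -((g - f) x)| := by
          congr 1; simp only [Pi.sub_apply]; ring
      _ ≤ _ := by
          refine (abs_add_le _ _).trans ?_
          rw [abs_neg]
          gcongr
          exact abs_add_le _ _
  have i4 : Integrable (fun x => |((φ k).normed μ ⋆[lsmul ℝ ℝ, μ] f) x - f x|) μ :=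
    (i2.sub hfi).abs
  rw [integral_add (by exact i1.abs.add i4) hd.abs, integral_add i1.abs i4] at hle
  have h3 : ∫ x, |(g - f) x| ∂μ ≤ ε / 4 := hfg
  linarith

end Mollification

/-! ### Smooth approximation of functions with a weak gradient. -/

section WeakGradient

variable {n : ℕ} {Ω : Set (EuclideanSpace ℝ (Fin n))} {u v : EuclideanSpace ℝ (Fin n) → ℝ}
  {Du Dv : EuclideanSpace ℝ (Fin n) → EuclideanSpace ℝ (Fin n)}

theorem HasWeakGradient.locallyIntegrableOn_apply (hu : HasWeakGradient Ω u Du) (i : Fin n) :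
    LocallyIntegrableOn (fun x => Du x i) Ω := by
  intro x hx
  obtain ⟨s, hs, hi⟩ := hu.locallyIntegrable_grad x hx
  exact ⟨s, hs, (EuclideanSpace.proj (𝕜 := ℝ) i).integrable_comp hi⟩

/-- The derivative falls on the kernel, and t ↦ ρ(x - t) is a test function supported in K, so the
weak gradient identity moves it onto u. The cutoff to K supplies global integrability and is
invisible to this kernel. -/
theorem HasWeakGradient.fderiv_normed_convolution (hu : HasWeakGradient Ω u Du)
    {K : Set (EuclideanSpace ℝ (Fin n))} (hK : IsCompact K) (hKΩ : K ⊆ Ω)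
    (φ : ContDiffBump (0 : EuclideanSpace ℝ (Fin n))) {x : EuclideanSpace ℝ (Fin n)}
    (hx : Metric.closedBall x φ.rOut ⊆ K) (i : Fin n) :
    fderiv ℝ (φ.normed volume ⋆[lsmul ℝ ℝ, volume] K.indicator u) x (EuclideanSpace.single i 1) =
      (φ.normed volume ⋆[lsmul ℝ ℝ, volume] K.indicator fun y => Du y i) x := by
  set ρ := φ.normed (volume : Measure (EuclideanSpace ℝ (Fin n))) with hρ
  have hρc : HasCompactSupport ρ := φ.hasCompactSupport_normed
  have hρs : ContDiff ℝ ∞ ρ := φ.contDiff_normed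
  have hρ1 : ContDiff ℝ 1 ρ := φ.contDiff_normed
  have hi : Integrable (K.indicator u) :=
    (integrable_indicator_iff hK.measurableSet).2
      (hu.locallyIntegrable.integrableOn_compact_subset hKΩ hK)
  have hψsupp : tsupport (fun t => ρ (x - t)) ⊆ Metric.closedBall x φ.rOut := by
    refine closure_minimal (fun t ht => ?_) Metric.isClosed_closedBall
    have h1 : x - t ∈ Function.support ρ := ht
    rw [hρ, φ.support_normed_eq, mem_ball_zero_iff] at h1
    rw [Metric.mem_closedBall, dist_comm, dist_eq_norm]
    exact h1.le
  have hψ : IsTestFunction Ω (fun t => ρ (x - t)) :=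
    ⟨hρs.comp (contDiff_const.sub contDiff_id),
      (isCompact_closedBall x φ.rOut).of_isClosed_subset (isClosed_tsupport _) hψsupp,
      hψsupp.trans (hx.trans hKΩ)⟩
  have hderiv : ∀ t, fderiv ℝ (fun t => ρ (x - t)) t = -fderiv ℝ ρ (x - t) := by
    intro t
    have h1 := (hρ1.differentiable one_ne_zero (x - t)).hasFDerivAt.comp t
      ((hasFDerivAt_id t).const_sub x)
    exact h1.fderiv.trans (by ext; simp)
  have hzero : ∀ t, t ∉ K → ρ (x - t) = 0 ∧ fderiv ℝ (fun t => ρ (x - t)) t = 0 := fun t ht =>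
    have ht' : t ∉ tsupport (fun t => ρ (x - t)) := fun h' => ht (hx (hψsupp h'))
    ⟨image_eq_zero_of_notMem_tsupport (f := fun t => ρ (x - t)) ht',
      fderiv_of_notMem_tsupport ℝ ht'⟩
  have hcd := hρc.hasFDerivAt_convolution_left (lsmul ℝ ℝ) hρ1 hi.locallyIntegrable x
  have hce := (hρc.fderiv (𝕜 := ℝ)).convolutionExists_left
    ((lsmul ℝ ℝ : ℝ →L[ℝ] ℝ →L[ℝ] ℝ).precompL (EuclideanSpace ℝ (Fin n)))
    (hρ1.continuous_fderiv one_ne_zero) hi.locallyIntegrable x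
  rw [hcd.fderiv, convolution_eq_swap, convolution_eq_swap,
    ContinuousLinearMap.integral_apply hce.integrable_swap]
  have hint := hu.integral_eq _ hψ i
  rw [setIntegral_eq_integral_of_forall_compl_eq_zero,
    setIntegral_eq_integral_of_forall_compl_eq_zero, ← neg_eq_iff_eq_neg, ← integral_neg] at hint
  · refine Eq.trans (integral_congr_ae (ae_of_all _ fun t => ?_))
      (hint.trans (integral_congr_ae (ae_of_all _ fun t => ?_)))
    · by_cases ht : t ∈ K
      · simp [hderiv, ht, mul_comm]
      · have h0 := (hzero t ht).2
        simp [h0, ht]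
    · by_cases ht : t ∈ K
      · simp [ht, mul_comm]
      · simp [(hzero t ht).1, ht]
  · intro t ht
    simp [(hzero t fun h' => ht (hKΩ h')).1]
  · intro t ht
    simp [(hzero t fun h' => ht (hKΩ h')).2]

theorem HasWeakGradient.exists_contDiff_approx (hu : HasWeakGradient Ω u Du) (hΩ : IsOpen Ω)
    {K : Set (EuclideanSpace ℝ (Fin n))} (hK : IsCompact K) (hKΩ : K ⊆ Ω) (i : Fin n) :
    ∃ v : ℕ → EuclideanSpace ℝ (Fin n) → ℝ, (∀ k, ContDiff ℝ 1 (v k)) ∧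
      (∀ᵐ x ∂volume.restrict K, Tendsto (fun k => v k x) atTop (𝓝 (u x))) ∧
      Tendsto (fun k => ∫ x in K, |v k x - u x|) atTop (𝓝 0) ∧
      Tendsto (fun k => ∫ x in K, |fderiv ℝ (v k) x (EuclideanSpace.single i 1) - Du x i|)
        atTop (𝓝 0) := by
  obtain ⟨δ, hδ, hδΩ⟩ := hK.exists_cthickening_subset_open hΩ hKΩ
  set L := Metric.cthickening δ K
  have hL : IsCompact L := hK.cthickening
  have hKL : K ⊆ L := Metric.self_subset_cthickening K
  have hi : Integrable (L.indicator u) := (integrable_indicator_iff hL.measurableSet).2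
      (hu.locallyIntegrable.integrableOn_compact_subset hδΩ hL)
  have hDi : Integrable (L.indicator fun y => Du y i) :=
    (integrable_indicator_iff hL.measurableSet).2
      ((hu.locallyIntegrableOn_apply i).integrableOn_compact_subset hδΩ hL)
  -- Radii at most δ keep the balls around points of K inside L; the fixed ratio 2 of outer to inner
  -- radius is what a.e. convergence requires.
  let φ : ℕ → ContDiffBump (0 : EuclideanSpace ℝ (Fin n)) := fun k =>
    ⟨δ / (k + 2) / 2, δ / (k + 2), by positivity, half_lt_self (by positivity)⟩
  have hφ : Tendsto (fun k => (φ k).rOut) atTop (𝓝 0) :=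
    tendsto_const_nhds.div_atTop
      (tendsto_atTop_add_const_right _ _ tendsto_natCast_atTop_atTop)
  have hφδ : ∀ k, (φ k).rOut ≤ δ := fun k =>
    div_le_self hδ.le (by linarith [(Nat.cast_nonneg k : (0 : ℝ) ≤ k)])
  refine ⟨fun k => (φ k).normed volume ⋆[lsmul ℝ ℝ, volume] L.indicator u, fun k => ?_, ?_, ?_, ?_⟩
  · exact (φ k).hasCompactSupport_normed.contDiff_convolution_left _ (n := 1)
      (φ k).contDiff_normed hi.locallyIntegrable
  · rw [ae_restrict_iff' hK.measurableSet]
    filter_upwards [ContDiffBump.ae_convolution_tendsto_right_of_locallyIntegrable (K := 2) hφ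
      (Eventually.of_forall fun k => by simp only [φ]; linarith) hi.locallyIntegrable] with x hx hxK
    rwa [Set.indicator_of_mem (hKL hxK)] at hx
  · refine squeeze_zero (fun k => integral_nonneg fun x => abs_nonneg _) (fun k => ?_)
      (tendsto_integral_abs_normed_convolution_sub hφ hi)
    refine (setIntegral_congr_fun hK.measurableSet fun x hx => ?_).trans_le
      (setIntegral_le_integral (((φ k).integrable_normed.integrable_convolution _ hi).sub hi).abs
        (ae_of_all _ fun x => abs_nonneg _))
    simp [Set.indicator_of_mem (hKL hx)]
  · refine squeeze_zero (fun k => integral_nonneg fun x => abs_nonneg _) (fun k => ?_)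
      (tendsto_integral_abs_normed_convolution_sub hφ hDi)
    refine (setIntegral_congr_fun hK.measurableSet fun x hx => ?_).trans_le
      (setIntegral_le_integral (((φ k).integrable_normed.integrable_convolution _ hDi).sub hDi).abs
        (ae_of_all _ fun x => abs_nonneg _))
    have hb : Metric.closedBall x (φ k).rOut ⊆ L := fun y hy =>
      Metric.mem_cthickening_of_dist_le y x δ K hx ((Metric.mem_closedBall.1 hy).trans (hφδ k))
    simp [Set.indicator_of_mem (hKL hx), hu.fderiv_normed_convolution hL hδΩ (φ k) hb i]

theorem integrableOn_mul_of_tsupport_subset {g φ : EuclideanSpace ℝ (Fin n) → ℝ}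
    (hΩ : IsOpen Ω) (hg : LocallyIntegrableOn g Ω) (hφ : Continuous φ) (hc : HasCompactSupport φ)
    (hs : tsupport φ ⊆ Ω) : IntegrableOn (fun x => g x * φ x) Ω := by
  have h1 : IntegrableOn (fun x => g x * φ x) (tsupport φ) :=
    (hg.integrableOn_compact_subset hs hc.isCompact).mul_continuousOn hφ.continuousOn hc.isCompact
  exact h1.of_forall_sdiff_eq_zero hΩ.measurableSet fun x hx => by
    simp [image_eq_zero_of_notMem_tsupport hx.2]

theorem IsTestFunction.continuous_fderiv_apply {φ : EuclideanSpace ℝ (Fin n) → ℝ}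
    (hφ : IsTestFunction Ω φ) (e : EuclideanSpace ℝ (Fin n)) :
    Continuous fun x => fderiv ℝ φ x e :=
  (hφ.smooth.continuous_fderiv (by simp)).clm_apply continuous_const

theorem IsTestFunction.tsupport_fderiv_apply {φ : EuclideanSpace ℝ (Fin n) → ℝ}
    (hφ : IsTestFunction Ω φ) (e : EuclideanSpace ℝ (Fin n)) :
    tsupport (fun x => fderiv ℝ φ x e) ⊆ Ω :=
  (tsupport_fderiv_apply_subset ℝ e).trans hφ.subset

theorem HasWeakGradient.integrableOn_mul_fderiv (hu : HasWeakGradient Ω u Du) (hΩ : IsOpen Ω)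
    {φ : EuclideanSpace ℝ (Fin n) → ℝ} (hφ : IsTestFunction Ω φ) (e : EuclideanSpace ℝ (Fin n)) :
    IntegrableOn (fun x => u x * fderiv ℝ φ x e) Ω :=
  integrableOn_mul_of_tsupport_subset hΩ hu.locallyIntegrable (hφ.continuous_fderiv_apply e)
    (hφ.compact.fderiv_apply ℝ e) (hφ.tsupport_fderiv_apply e)

theorem HasWeakGradient.integrableOn_apply_mul (hu : HasWeakGradient Ω u Du) (hΩ : IsOpen Ω)
    {φ : EuclideanSpace ℝ (Fin n) → ℝ} (hφ : IsTestFunction Ω φ) (i : Fin n) :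
    IntegrableOn (fun x => Du x i * φ x) Ω :=
  integrableOn_mul_of_tsupport_subset hΩ (hu.locallyIntegrableOn_apply i) hφ.smooth.continuous
    hφ.compact hφ.subset

theorem HasWeakGradient.sub (hu : HasWeakGradient Ω u Du) (hv : HasWeakGradient Ω v Dv)
    (hΩ : IsOpen Ω) : HasWeakGradient Ω (fun x => u x - v x) (fun x => Du x - Dv x) where
  locallyIntegrable := hu.locallyIntegrable.sub hv.locallyIntegrable
  locallyIntegrable_grad := hu.locallyIntegrable_grad.sub hv.locallyIntegrable_grad
  integral_eq φ hφ i := by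
    simp only [sub_mul, PiLp.sub_apply]
    rw [integral_sub (hu.integrableOn_mul_fderiv hΩ hφ _) (hv.integrableOn_mul_fderiv hΩ hφ _),
      integral_sub (hu.integrableOn_apply_mul hΩ hφ i) (hv.integrableOn_apply_mul hΩ hφ i),
      hu.integral_eq φ hφ i, hv.integral_eq φ hφ i]
    ring

/-! ### The chain rule for weak gradients. -/

theorem abs_sub_le_of_abs_deriv_le {f f' : ℝ → ℝ} {M : ℝ} (hf : ∀ t, HasDerivAt f (f' t) t)
    (hM : ∀ t, |f' t| ≤ M) (a b : ℝ) : |f a - f b| ≤ M * |a - b| :=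
  convex_univ.norm_image_sub_le_of_norm_hasDerivWithin_le (fun t _ => (hf t).hasDerivWithinAt)
    (fun t _ => hM t) (Set.mem_univ b) (Set.mem_univ a)

theorem integral_comp_mul_fderiv_eq_neg {f f' : ℝ → ℝ} (hf : ∀ t, HasDerivAt f (f' t) t)
    (hf' : Continuous f') {w φ : EuclideanSpace ℝ (Fin n) → ℝ} (hw : ContDiff ℝ 1 w)
    (hφ : ContDiff ℝ 1 φ) (hc : HasCompactSupport φ) (e : EuclideanSpace ℝ (Fin n)) :
    ∫ x, f (w x) * fderiv ℝ φ x e = -∫ x, f' (w x) * fderiv ℝ w x e * φ x := by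
  have hfc : Continuous f := continuous_iff_continuousAt.2 fun t => (hf t).continuousAt
  have hd : ∀ x, HasFDerivAt (fun x => f (w x)) (f' (w x) • fderiv ℝ w x) x := fun x =>
    (hf (w x)).comp_hasFDerivAt x (hw.differentiable one_ne_zero x).hasFDerivAt
  have hde : ∀ x, fderiv ℝ (fun x => f (w x)) x e = f' (w x) * fderiv ℝ w x e := fun x => by
    rw [(hd x).fderiv]; simp
  have cw := (hw.continuous_fderiv one_ne_zero).clm_apply (continuous_const (y := e))
  have cφ := (hφ.continuous_fderiv one_ne_zero).clm_apply (continuous_const (y := e))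
  have hfw := hfc.comp hw.continuous
  have hfw' := hf'.comp hw.continuous
  have := integral_mul_fderiv_eq_neg_fderiv_mul_of_integrable (μ := volume)
    (f := fun x => f (w x)) (g := φ) (v := e) ?_ ?_ ?_
    (fun x _ => (hd x).differentiableAt) (fun x _ => hφ.differentiable one_ne_zero x)
  · simpa only [hde] using this
  · simp only [hde]
    exact ((hfw'.mul cw).mul hφ.continuous).integrable_of_hasCompactSupport hc.mul_left
  · exact (hfw.mul cφ).integrable_of_hasCompactSupport (hc.fderiv_apply ℝ e).mul_left
  · exact (hfw.mul hφ.continuous).integrable_of_hasCompactSupport hc.mul_left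

/-- The limit passage in the chain rule for weak derivatives. -/
theorem integral_comp_mul_eq_neg_of_tendsto {α : Type*} [MeasurableSpace α] {μ : Measure α}
    [IsFiniteMeasure μ] {f f' : ℝ → ℝ} {M : ℝ} (hf : ∀ t, HasDerivAt f (f' t) t)
    (hf' : Continuous f') (hM : ∀ t, |f' t| ≤ M) {v dv : ℕ → α → ℝ} {u du ψ φ : α → ℝ}
    (hv : ∀ k, Integrable (v k) μ) (hdv : ∀ k, Integrable (dv k) μ) (hu : Integrable u μ)
    (hdu : Integrable du μ) (hψ : AEStronglyMeasurable ψ μ) (hφ : AEStronglyMeasurable φ μ)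
    {C : ℝ} (hψC : ∀ x, |ψ x| ≤ C) (hφC : ∀ x, |φ x| ≤ C)
    (hvu : ∀ᵐ x ∂μ, Tendsto (fun k => v k x) atTop (𝓝 (u x)))
    (hvu1 : Tendsto (fun k => ∫ x, |v k x - u x| ∂μ) atTop (𝓝 0))
    (hdvu1 : Tendsto (fun k => ∫ x, |dv k x - du x| ∂μ) atTop (𝓝 0))
    (heq : ∀ k, ∫ x, f (v k x) * ψ x ∂μ = -∫ x, f' (v k x) * dv k x * φ x ∂μ) :
    ∫ x, f (u x) * ψ x ∂μ = -∫ x, f' (u x) * du x * φ x ∂μ := by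
  have hM0 : 0 ≤ M := (abs_nonneg _).trans (hM 0)
  have hfc : Continuous f := continuous_iff_continuousAt.2 fun t => (hf t).continuousAt
  have hfi : ∀ w : α → ℝ, Integrable w μ → Integrable (fun x => f (w x)) μ := by
    intro w hw
    refine ((integrable_const |f 0|).add (hw.abs.const_mul M)).mono'
      (hfc.comp_aestronglyMeasurable hw.aestronglyMeasurable) (ae_of_all _ fun x => ?_)
    have := abs_sub_le_of_abs_deriv_le hf hM (w x) 0
    rw [sub_zero] at this
    calc ‖f (w x)‖ = |f 0 + (f (w x) - f 0)| := by rw [Real.norm_eq_abs]; ring_nf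
      _ ≤ _ := (abs_add_le _ _).trans (by simpa using this)
  have hf'i : ∀ w g : α → ℝ, Integrable w μ → Integrable g μ →
      Integrable (fun x => f' (w x) * g x) μ := fun w g hw hg =>
    hg.bdd_mul (hf'.comp_aestronglyMeasurable hw.aestronglyMeasurable)
      (ae_of_all _ fun x => hM (w x))
  have hψi : ∀ w : α → ℝ, Integrable w μ → Integrable (fun x => w x * ψ x) μ := fun w hw =>
    hw.mul_bdd hψ (ae_of_all _ hψC)
  have hφi : ∀ w : α → ℝ, Integrable w μ → Integrable (fun x => w x * φ x) μ := fun w hw =>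
    hw.mul_bdd hφ (ae_of_all _ hφC)
  have hA : Tendsto (fun k => ∫ x, f (v k x) * ψ x ∂μ) atTop (𝓝 (∫ x, f (u x) * ψ x ∂μ)) := by
    rw [tendsto_iff_norm_sub_tendsto_zero]
    refine squeeze_zero (fun k => norm_nonneg _) (fun k => ?_)
      (by simpa using hvu1.const_mul (M * C))
    rw [← integral_sub (hψi _ (hfi _ (hv k))) (hψi _ (hfi _ hu)), ← integral_const_mul]
    refine (norm_integral_le_integral_norm _).trans (integral_mono
      ((hψi _ (hfi _ (hv k))).sub (hψi _ (hfi _ hu))).norm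
      (((hv k).sub hu).abs.const_mul _) fun x => ?_)
    simp only [Real.norm_eq_abs, ← sub_mul, abs_mul]
    have := abs_sub_le_of_abs_deriv_le hf hM (v k x) (u x)
    calc _ ≤ (M * |v k x - u x|) * C := by gcongr; exact hψC x
      _ = _ := by ring
  -- Split f'(v_k) dv_k into f'(v_k)(dv_k - du), small in L¹ because f' is bounded, and f'(v_k) du,
  -- handled by dominated convergence.
  have hB1 : Tendsto (fun k => ∫ x, f' (v k x) * (dv k x - du x) * φ x ∂μ) atTop (𝓝 0) := by
    rw [tendsto_zero_iff_norm_tendsto_zero]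
    refine squeeze_zero (fun k => norm_nonneg _) (fun k => ?_)
      (by simpa using hdvu1.const_mul (M * C))
    rw [← integral_const_mul]
    refine (norm_integral_le_integral_norm _).trans (integral_mono
      (hφi _ (hf'i _ _ (hv k) ((hdv k).sub hdu))).norm
      (((hdv k).sub hdu).abs.const_mul _) fun x => ?_)
    simp only [Real.norm_eq_abs, abs_mul]
    calc _ ≤ (M * |dv k x - du x|) * C := by gcongr; exacts [hM _, hφC x]
      _ = _ := by ring
  have hB2 : Tendsto (fun k => ∫ x, f' (v k x) * du x * φ x ∂μ) atTop
      (𝓝 (∫ x, f' (u x) * du x * φ x ∂μ)) := by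
    refine tendsto_integral_of_dominated_convergence (fun x => M * |du x| * C)
      (fun k => (hφi _ (hf'i _ _ (hv k) hdu)).aestronglyMeasurable)
      ((hdu.abs.const_mul M).mul_const C) (fun k => ae_of_all _ fun x => ?_) ?_
    · rw [Real.norm_eq_abs, abs_mul, abs_mul]
      gcongr
      exacts [hM _, hφC x]
    · filter_upwards [hvu] with x hx
      exact (((hf'.tendsto _).comp hx).mul_const _).mul_const _
  have hB : Tendsto (fun k => ∫ x, f' (v k x) * dv k x * φ x ∂μ) atTop
      (𝓝 (∫ x, f' (u x) * du x * φ x ∂μ)) := by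
    have := hB1.add hB2
    rw [zero_add] at this
    refine this.congr fun k => ?_
    rw [← integral_add (by exact hφi _ (hf'i _ _ (hv k) ((hdv k).sub hdu)))
      (hφi _ (hf'i _ _ (hv k) hdu))]
    exact integral_congr_ae (ae_of_all _ fun x => by ring)
  exact tendsto_nhds_unique hA (hB.neg.congr fun k => (heq k).symm)

/-- Chain rule for weak gradients. -/
theorem HasWeakGradient.comp (hu : HasWeakGradient Ω u Du) (hΩ : IsOpen Ω) {f f' : ℝ → ℝ} {M : ℝ}
    (hf : ∀ t, HasDerivAt f (f' t) t) (hf' : Continuous f') (hM : ∀ t, |f' t| ≤ M) :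
    HasWeakGradient Ω (fun x => f (u x)) (fun x => f' (u x) • Du x) where
  locallyIntegrable := by
    have hfc : Continuous f := continuous_iff_continuousAt.2 fun t => (hf t).continuousAt
    rw [locallyIntegrableOn_iff hΩ.isLocallyClosed]
    intro K hKΩ hK
    have hui := hu.locallyIntegrable.integrableOn_compact_subset hKΩ hK
    refine ((integrableOn_const hK.measure_lt_top.ne (C := |f 0|)).add
      (hui.abs.const_mul M)).mono'
      (hfc.comp_aestronglyMeasurable hui.aestronglyMeasurable) (ae_of_all _ fun x => ?_)
    have := abs_sub_le_of_abs_deriv_le hf hM (u x) 0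
    rw [sub_zero] at this
    calc ‖f (u x)‖ = |f 0 + (f (u x) - f 0)| := by rw [Real.norm_eq_abs]; ring_nf
      _ ≤ _ := (abs_add_le _ _).trans (by simpa using this)
  locallyIntegrable_grad := by
    rw [locallyIntegrableOn_iff hΩ.isLocallyClosed]
    intro K hKΩ hK
    have hui := hu.locallyIntegrable.integrableOn_compact_subset hKΩ hK
    have hDi := hu.locallyIntegrable_grad.integrableOn_compact_subset hKΩ hK
    exact hDi.bdd_smul _ (hf'.comp_aestronglyMeasurable hui.aestronglyMeasurable)
      (ae_of_all _ fun x => hM (u x))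
  integral_eq φ hφ i := by
    set e : EuclideanSpace ℝ (Fin n) := EuclideanSpace.single i 1
    set K := tsupport φ
    have hK : IsCompact K := hφ.compact.isCompact
    have : IsFiniteMeasure (volume.restrict K) := ⟨by simpa using hK.measure_lt_top⟩
    have hφ1 : ContDiff ℝ 1 φ := hφ.smooth.of_le (by simp)
    have hφ0 : ∀ x, x ∉ K → φ x = 0 := fun x hx => image_eq_zero_of_notMem_tsupport hx
    have hφ0' : ∀ x, x ∉ K → fderiv ℝ φ x e = 0 := fun x hx => by
      rw [fderiv_of_notMem_tsupport ℝ hx]; rfl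
    obtain ⟨C₁, hC₁⟩ := hφ.compact.exists_bound_of_continuous hφ.smooth.continuous
    obtain ⟨C₂, hC₂⟩ := (hφ.compact.fderiv_apply ℝ e).exists_bound_of_continuous
      (hφ.continuous_fderiv_apply e)
    obtain ⟨v, hv, hvu, hvu1, hdvu1⟩ := hu.exists_contDiff_approx hΩ hK hφ.subset i
    have key := integral_comp_mul_eq_neg_of_tendsto (μ := volume.restrict K) hf hf' hM
      (v := v) (dv := fun k x => fderiv ℝ (v k) x e) (u := u) (du := fun x => Du x i)
      (ψ := fun x => fderiv ℝ φ x e) (φ := φ) (C := max C₁ C₂)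
      (fun k => (hv k).continuous.continuousOn.integrableOn_compact hK)
      (fun k => (((hv k).continuous_fderiv one_ne_zero).clm_apply
        continuous_const).continuousOn.integrableOn_compact hK)
      (hu.locallyIntegrable.integrableOn_compact_subset hφ.subset hK)
      ((hu.locallyIntegrableOn_apply i).integrableOn_compact_subset hφ.subset hK)
      (hφ.continuous_fderiv_apply e).aestronglyMeasurable hφ.smooth.continuous.aestronglyMeasurable
      (fun x => (hC₂ x).trans (le_max_right _ _)) (fun x => (hC₁ x).trans (le_max_left _ _))
      hvu hvu1 hdvu1 fun k => by
        have := integral_comp_mul_fderiv_eq_neg hf hf' (hv k) hφ1 hφ.compact e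
        rwa [← setIntegral_eq_integral_of_forall_compl_eq_zero (s := K)
            (f := fun x => f (v k x) * fderiv ℝ φ x e) fun x hx => by simp [hφ0' x hx],
          ← setIntegral_eq_integral_of_forall_compl_eq_zero (s := K)
            (f := fun x => f' (v k x) * fderiv ℝ (v k) x e * φ x) fun x hx => by
              simp [hφ0 x hx]] at this
    rw [setIntegral_eq_of_subset_of_forall_sdiff_eq_zero hΩ.measurableSet hφ.subset,
      setIntegral_eq_of_subset_of_forall_sdiff_eq_zero hΩ.measurableSet hφ.subset]
    · simpa using key
    · intro x hx; simp [hφ0 x hx.2]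
    · intro x hx; simp [hφ0' x hx.2]

/-! ### Weak gradients on level sets. -/

theorem hasDerivAt_arctan_div (c a t : ℝ) (ha : a ≠ 0) :
    HasDerivAt (fun t => Real.arctan (a * (t - c)) / a) (1 / (1 + (a * (t - c)) ^ 2)) t := by
  have h1 : HasDerivAt (fun t => a * (t - c)) (a * 1) t :=
    ((hasDerivAt_id t).sub_const c).const_mul a
  refine (h1.arctan.div_const a).congr_deriv ?_
  field_simp

theorem tendsto_one_div_one_add_sq (s : ℝ) :
    Tendsto (fun k : ℕ => 1 / (1 + (((k : ℝ) + 1) * s) ^ 2)) atTop (𝓝 (if s = 0 then 1 else 0)) := by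
  split_ifs with hs
  · simp [hs]
  · have h1 : Tendsto (fun k : ℕ => (k : ℝ) + 1) atTop atTop :=
      tendsto_atTop_add_const_right _ _ tendsto_natCast_atTop_atTop
    have h2 : Tendsto (fun k : ℕ => 1 + ((k : ℝ) + 1) ^ 2 * s ^ 2) atTop atTop :=
      tendsto_atTop_add_const_left _ _
        (((tendsto_pow_atTop two_ne_zero).comp h1).atTop_mul_const (by positivity))
    simp only [mul_pow]
    exact tendsto_const_nhds.div_atTop h2

/-- The weak gradient vanishes almost everywhere on each level set. -/
theorem HasWeakGradient.ae_eq_zero_of_eq (hu : HasWeakGradient Ω u Du) (hΩ : IsOpen Ω) (c : ℝ) :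
    ∀ᵐ x ∂volume.restrict Ω, u x = c → Du x = 0 := by
  suffices h : ∀ i, ∀ᵐ x ∂volume.restrict Ω, (if u x - c = 0 then 1 else 0) * Du x i = 0 by
    filter_upwards [ae_all_iff.2 h] with x hx hc
    ext i
    simpa [hc] using hx i
  intro i
  have hpos : ∀ k : ℕ, ((k : ℝ) + 1) ≠ 0 := fun k => by positivity
  have hcont : ∀ k : ℕ, Continuous fun t : ℝ => 1 / (1 + (((k : ℝ) + 1) * (t - c)) ^ 2) := fun k =>
    continuous_const.div (by fun_prop) fun t => by positivity
  have hbd : ∀ (k : ℕ) (t : ℝ), |1 / (1 + (((k : ℝ) + 1) * (t - c)) ^ 2)| ≤ 1 := fun k t => by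
    rw [abs_of_nonneg (by positivity)]
    exact div_le_one_of_le₀ (by nlinarith [sq_nonneg (((k : ℝ) + 1) * (t - c))]) (by positivity)
  -- These functions of u tend uniformly to 0, while their derivatives stay in [0,1] and tend to the
  -- indicator of {u = c}. Passing to the limit in the weak identity shows that this indicator times
  -- ∇u integrates to zero against every test function.
  have hchain : ∀ k : ℕ, HasWeakGradient Ω
      (fun x => Real.arctan (((k : ℝ) + 1) * (u x - c)) / ((k : ℝ) + 1))
      (fun x => (1 / (1 + (((k : ℝ) + 1) * (u x - c)) ^ 2)) • Du x) := fun k =>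
    hu.comp hΩ (fun t => hasDerivAt_arctan_div c _ t (hpos k)) (hcont k) (hbd k)
  have hlim : ∀ x, Tendsto (fun k : ℕ => 1 / (1 + (((k : ℝ) + 1) * (u x - c)) ^ 2) * Du x i) atTop
      (𝓝 ((if u x - c = 0 then 1 else 0) * Du x i)) := fun x =>
    (tendsto_one_div_one_add_sq (u x - c)).mul_const _
  have hDi := hu.locallyIntegrableOn_apply i
  have hum : AEStronglyMeasurable u (volume.restrict Ω) := hu.locallyIntegrable.aestronglyMeasurable
  have hDm : AEStronglyMeasurable (fun x => Du x i) (volume.restrict Ω) := hDi.aestronglyMeasurable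
  have hm : AEStronglyMeasurable (fun x => (if u x - c = 0 then 1 else 0) * Du x i)
      (volume.restrict Ω) :=
    aestronglyMeasurable_of_tendsto_ae atTop
      (fun k : ℕ => ((hcont k).comp_aestronglyMeasurable hum).mul hDm) (ae_of_all _ hlim)
  have hloc : LocallyIntegrableOn (fun x => (if u x - c = 0 then 1 else 0) * Du x i) Ω := by
    rw [locallyIntegrableOn_iff hΩ.isLocallyClosed]
    intro K hKΩ hK
    refine Integrable.mono (hDi.integrableOn_compact_subset hKΩ hK)
      (hm.mono_measure (Measure.restrict_mono hKΩ le_rfl)) (ae_of_all _ fun x => ?_)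
    split_ifs <;> simp
  rw [ae_restrict_iff' hΩ.measurableSet]
  refine hΩ.ae_eq_zero_of_integral_contDiff_smul_eq_zero hloc fun φ hφ hc hs => ?_
  have hφt : IsTestFunction Ω φ := ⟨hφ, hc, hs⟩
  rw [← setIntegral_eq_integral_of_forall_compl_eq_zero (s := Ω) fun x hx => by
    simp [image_eq_zero_of_notMem_tsupport fun h' => hx (hs h')]]
  have hR : Tendsto
      (fun k : ℕ => ∫ x in Ω, ((1 / (1 + (((k : ℝ) + 1) * (u x - c)) ^ 2)) • Du x) i * φ x) atTop
      (𝓝 (∫ x in Ω, φ x • ((if u x - c = 0 then 1 else 0) * Du x i))) := by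
    refine tendsto_integral_of_dominated_convergence (fun x => |Du x i * φ x|)
      (fun k => ((hchain k).integrableOn_apply_mul hΩ hφt i).aestronglyMeasurable)
      (hu.integrableOn_apply_mul hΩ hφt i).abs (fun k => ae_of_all _ fun x => ?_)
      (ae_of_all _ fun x => ?_)
    · rw [PiLp.smul_apply, smul_eq_mul, mul_assoc, Real.norm_eq_abs, abs_mul]
      exact mul_le_of_le_one_left (abs_nonneg _) (hbd k _)
    · have := (hlim x).mul_const (φ x)
      simpa only [PiLp.smul_apply, smul_eq_mul, mul_comm (φ x)] using this
  have hL : Tendsto (fun k : ℕ => ∫ x in Ω, Real.arctan (((k : ℝ) + 1) * (u x - c)) / ((k : ℝ) + 1) *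
      fderiv ℝ φ x (EuclideanSpace.single i 1)) atTop (𝓝 (∫ x in Ω, (0 : ℝ))) := by
    have hint : Integrable fun x => fderiv ℝ φ x (EuclideanSpace.single i 1) :=
      (hφt.continuous_fderiv_apply _).integrable_of_hasCompactSupport (hc.fderiv_apply ℝ _)
    have harc : ∀ t, |Real.arctan t| ≤ Real.pi / 2 := fun t =>
      abs_le.2 ⟨(Real.neg_pi_div_two_lt_arctan t).le, (Real.arctan_lt_pi_div_two t).le⟩
    have hle : ∀ (k : ℕ) (t : ℝ), |Real.arctan t / ((k : ℝ) + 1)| ≤ Real.pi / 2 / ((k : ℝ) + 1) :=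
      fun k t => by
        rw [abs_div, abs_of_nonneg (by positivity : (0 : ℝ) ≤ (k : ℝ) + 1)]
        gcongr
        exact harc t
    refine tendsto_integral_of_dominated_convergence
      (fun x => Real.pi / 2 * |fderiv ℝ φ x (EuclideanSpace.single i 1)|)
      (fun k => ((hchain k).integrableOn_mul_fderiv hΩ hφt _).aestronglyMeasurable)
      (hint.abs.const_mul _).integrableOn (fun k => ae_of_all _ fun x => ?_)
      (ae_of_all _ fun x => ?_)
    · rw [Real.norm_eq_abs, abs_mul]
      gcongr
      exact (hle k _).trans (div_le_self (by positivity) (by simp))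
    · have h0 : Tendsto (fun k : ℕ => Real.arctan (((k : ℝ) + 1) * (u x - c)) / ((k : ℝ) + 1)) atTop
          (𝓝 0) :=
        squeeze_zero_norm (fun k => hle k _) (tendsto_const_nhds.div_atTop
          (tendsto_atTop_add_const_right _ _ tendsto_natCast_atTop_atTop))
      simpa using h0.mul_const (fderiv ℝ φ x (EuclideanSpace.single i 1))
  rw [integral_zero] at hL
  have := tendsto_nhds_unique (hR.neg.congr fun k => ((hchain k).integral_eq φ hφt i).symm) hL
  simpa using this

/-- This is the zero level set of u - v. With u = v it also gives a.e. uniqueness of the weak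
gradient. -/
theorem HasWeakGradient.ae_eq_of_eq (hu : HasWeakGradient Ω u Du) (hv : HasWeakGradient Ω v Dv)
    (hΩ : IsOpen Ω) : ∀ᵐ x ∂volume.restrict Ω, u x = v x → Du x = Dv x := by
  filter_upwards [(hu.sub hv hΩ).ae_eq_zero_of_eq hΩ 0] with x hx h
  exact sub_eq_zero.1 (hx (sub_eq_zero.2 h))

/-! ### Existence of Poincaré constants. -/

theorem norm_gradient_eq (φ : EuclideanSpace ℝ (Fin n) → ℝ) (x : EuclideanSpace ℝ (Fin n)) :
    ‖gradient φ x‖ = ‖fderiv ℝ φ x‖ :=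
  LinearIsometryEquiv.norm_map _ _

/-- Poincaré inequality for test functions. -/
theorem exists_integral_abs_le_integral_norm_gradient (hn : 2 ≤ n) (hb : Bornology.IsBounded Ω) :
    ∃ C : ℝ, 0 < C ∧ ∀ φ, IsTestFunction Ω φ →
      ∫ x in Ω, |φ x| ≤ C * ∫ x in Ω, ‖gradient φ x‖ := by
  -- The Gagliardo–Nirenberg–Sobolev constant with p = q = 1, available because 1 < n and Ω is
  -- bounded; adding 1 below makes it positive.
  set C := eLpNormLESNormFDerivOfLeConst ℝ
    (volume : Measure (EuclideanSpace ℝ (Fin n))) Ω 1 1 with hC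
  refine ⟨C + 1, by positivity, fun φ hφ => ?_⟩
  have hφ1 : ContDiff ℝ 1 φ := hφ.smooth.of_le (by simp)
  have hfin : (1 : NNReal) < Module.finrank ℝ (EuclideanSpace ℝ (Fin n)) := by
    rw [finrank_euclideanSpace_fin]; exact_mod_cast hn
  have h1 := eLpNorm_le_eLpNorm_fderiv_of_le (volume : Measure (EuclideanSpace ℝ (Fin n))) (p := 1)
    (q := 1) hφ1 ((subset_tsupport φ).trans hφ.subset) le_rfl hfin (by simp) hb
  have hg : Integrable (fderiv ℝ φ) :=
    (hφ1.continuous_fderiv one_ne_zero).integrable_of_hasCompactSupport (hφ.compact.fderiv ℝ)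
  rw [← hC, ENNReal.coe_one, eLpNorm_one_eq_lintegral_enorm, eLpNorm_one_eq_lintegral_enorm] at h1
  have h2 := ENNReal.toReal_mono (ENNReal.mul_ne_top ENNReal.coe_ne_top hg.2.ne) h1
  rw [ENNReal.toReal_mul, ← integral_norm_eq_lintegral_enorm hφ1.continuous.aestronglyMeasurable,
    ← integral_norm_eq_lintegral_enorm hg.aestronglyMeasurable, ENNReal.coe_toReal] at h2
  simp only [norm_gradient_eq]
  rw [setIntegral_eq_integral_of_forall_compl_eq_zero (s := Ω) fun x hx => by
      simp [image_eq_zero_of_notMem_tsupport fun h' => hx (hφ.subset h')],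
    setIntegral_eq_integral_of_forall_compl_eq_zero (s := Ω) fun x hx => by
      simp [fderiv_of_notMem_tsupport ℝ fun h' => hx (hφ.subset h')]]
  refine h2.trans ?_
  gcongr
  simp

theorem exists_isPoincareConstant (hn : 2 ≤ n) (hΩ : IsOpen Ω) (hb : Bornology.IsBounded Ω) :
    ∃ C : ℝ, IsPoincareConstant Ω C := by
  obtain ⟨C, hC, hle⟩ := exists_integral_abs_le_integral_norm_gradient hn hb
  refine ⟨C, hC, fun w Dw hw hDw => ?_⟩
  obtain ⟨Dw', hDw', hi, hDi, happrox⟩ := hw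
  have hcongr : ∫ x in Ω, ‖Dw x‖ = ∫ x in Ω, ‖Dw' x‖ := by
    refine integral_congr_ae ?_
    filter_upwards [hDw.ae_eq_of_eq hDw' hΩ] with x hx
    rw [hx rfl]
  rw [hcongr]
  refine le_of_forall_pos_le_add fun ε hε => ?_
  -- The function error enters with factor 1 and the gradient error with factor C, so 1 + C covers
  -- both.
  obtain ⟨φ, hφ, hlt⟩ := happrox (ε / (1 + C)) (by positivity)
  have hφi : IntegrableOn φ Ω :=
    (hφ.smooth.continuous.integrable_of_hasCompactSupport hφ.compact).integrableOn
  have hgc : Continuous (gradient φ) :=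
    (InnerProductSpace.toDual ℝ _).symm.continuous.comp (hφ.smooth.continuous_fderiv (by simp))
  have hgi : IntegrableOn (gradient φ) Ω := by
    refine (((hφ.smooth.continuous_fderiv (by simp)).integrable_of_hasCompactSupport
      (hφ.compact.fderiv ℝ)).mono hgc.aestronglyMeasurable
      (ae_of_all _ fun x => (norm_gradient_eq φ x).le)).integrableOn
  have hA : ∫ x in Ω, |w x| ≤ (∫ x in Ω, |w x - φ x|) + ∫ x in Ω, |φ x| := by
    rw [← integral_add (by exact (hi.sub hφi).abs) hφi.abs]
    refine integral_mono hi.abs (by exact (hi.sub hφi).abs.add hφi.abs) fun x => ?_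
    simpa using abs_add_le (w x - φ x) (φ x)
  have hB : ∫ x in Ω, ‖gradient φ x‖ ≤ (∫ x in Ω, ‖Dw' x - gradient φ x‖) + ∫ x in Ω, ‖Dw' x‖ := by
    rw [← integral_add (by exact (hDi.sub hgi).norm) hDi.norm]
    refine integral_mono hgi.norm (by exact (hDi.sub hgi).norm.add hDi.norm) fun x => ?_
    have := norm_add_le (gradient φ x - Dw' x) (Dw' x)
    rwa [sub_add_cancel, norm_sub_rev] at this
  have h0 : 0 ≤ ∫ x in Ω, |w x - φ x| := integral_nonneg fun x => abs_nonneg _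
  have h0' : 0 ≤ ∫ x in Ω, ‖Dw' x - gradient φ x‖ := integral_nonneg fun x => norm_nonneg _
  have h1 := hle φ hφ
  have h2 := mul_le_mul_of_nonneg_left hB hC.le
  rw [lt_div_iff₀ (by positivity)] at hlt
  nlinarith

end WeakGradient

/-! ### The interval (0,B) and C¹ extension from compact subintervals. -/

section Interval

variable {B : EReal}

theorem isOpen_openInterval (B : EReal) : IsOpen (openInterval B) :=
  isOpen_Ioi.inter (isOpen_Iio.preimage continuous_coe_real_ereal)

theorem Icc_subset_openInterval {a b : ℝ} (ha : a ∈ openInterval B) (hb : b ∈ openInterval B) :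
    Set.Icc a b ⊆ openInterval B := fun _ hs =>
  ⟨ha.1.trans_le hs.1, (EReal.coe_le_coe_iff.2 hs.2).trans_lt hb.2⟩

/-- Rational endpoints leave only countably many exceptional null sets to unite. -/
theorem exists_rat_mem_openInterval {s : ℝ} (hs : s ∈ openInterval B) :
    ∃ a b : ℚ, (a : ℝ) ∈ openInterval B ∧ (b : ℝ) ∈ openInterval B ∧ (a : ℝ) ≤ s ∧ s ≤ b := by
  obtain ⟨a, ha0, has⟩ := exists_rat_btwn hs.1
  obtain ⟨b, hsb, hbB⟩ := EReal.lt_iff_exists_rat_btwn.1 hs.2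
  have hsb' : s < b := EReal.coe_lt_coe_iff.1 hsb
  exact ⟨a, b, ⟨ha0, (EReal.coe_lt_coe_iff.2 has).trans hs.2⟩, ⟨hs.1.trans hsb', hbB⟩,
    has.le, hsb'.le⟩

/-- For B = ∞ only s = 0 occurs, and the default value `B.toReal = 0` does no harm. -/
theorem eq_zero_or_eq_toReal_of_mem_closedInterval {s : ℝ} (hs : s ∈ closedInterval B)
    (hs' : s ∉ openInterval B) : s = 0 ∨ s = B.toReal := by
  rcases hs.1.eq_or_lt with h0 | h0
  · exact Or.inl h0.symm
  · rcases hs.2.eq_or_lt with h1 | h1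
    · exact Or.inr (by rw [← h1, EReal.toReal_coe])
    · exact absurd ⟨h0, h1⟩ hs'

end Interval

/-- A function that is `C¹` on `[a, b]` extends to a `C¹` function with bounded derivative. -/
theorem exists_hasDerivAt_extension {F F' : ℝ → ℝ} {a b : ℝ} (hab : a ≤ b)
    (hF : ∀ s ∈ Set.Icc a b, HasDerivAt F (F' s) s) (hF' : ContinuousOn F' (Set.Icc a b)) :
    ∃ (f f' : ℝ → ℝ) (M : ℝ), (∀ t, HasDerivAt f (f' t) t) ∧ Continuous f' ∧ (∀ t, |f' t| ≤ M) ∧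
      ∀ s ∈ Set.Icc a b, f s = F s ∧ f' s = F' s := by
  -- Clamping the argument to [a,b] freezes F' at its endpoint values outside; f is then the
  -- antiderivative starting from F a.
  set f' : ℝ → ℝ := fun t => F' (max a (min b t)) with hf'
  have hmem : ∀ t, max a (min b t) ∈ Set.Icc a b := fun t =>
    ⟨le_max_left _ _, max_le hab (min_le_left _ _)⟩
  have heq : ∀ t ∈ Set.Icc a b, f' t = F' t := fun t ht => by
    simp only [hf', min_eq_right ht.2, max_eq_right ht.1]
  have hc : Continuous f' := hF'.comp_continuous (by fun_prop) hmem
  obtain ⟨M, hM⟩ := isCompact_Icc.exists_bound_of_continuousOn hF'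
  refine ⟨fun t => F a + ∫ s in a..t, f' s, f', M, fun t => ?_, hc, fun t => hM _ (hmem t),
    fun s hs => ⟨?_, heq s hs⟩⟩
  · exact (hc.integral_hasStrictDerivAt a t).hasDerivAt.const_add _
  · have : ∫ t in a..s, f' t = F s - F a := by
      refine intervalIntegral.integral_eq_sub_of_hasDerivAt (fun t ht => ?_)
        (hc.intervalIntegrable _ _)
      rw [Set.uIcc_of_le hs.1] at ht
      have ht' : t ∈ Set.Icc a b := ⟨ht.1, ht.2.trans hs.2⟩
      rw [heq t ht']
      exact hF t ht'
    simp [this]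

/-! ### The weak gradient of H̃(u). -/

theorem ae_weakGradient_comp_eq {n : ℕ} {Ω : Set (EuclideanSpace ℝ (Fin n))}
    {B : EReal} {h H Ht : ℝ → ℝ} {I : Set ℝ} (hI : IsAdmissibleInterval B h H Ht I)
    (hΩ : IsOpen Ω) {u : EuclideanSpace ℝ (Fin n) → ℝ}
    {Du Dv : EuclideanSpace ℝ (Fin n) → EuclideanSpace ℝ (Fin n)}
    (hu : HasWeakGradient Ω u Du) (huI : ∀ᵐ x ∂(volume.restrict Ω), u x ∈ I)
    (hv : HasWeakGradient Ω (fun x => Ht (u x)) Dv) :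
    ∀ᵐ x ∂volume.restrict Ω, (u x ∈ openInterval B → Dv x = H (u x) • Du x) ∧
      (u x ∉ openInterval B → Dv x = 0) := by
  have hIcc : ∀ a b : ℚ, (a : ℝ) ∈ openInterval B → (b : ℝ) ∈ openInterval B →
      ∀ᵐ x ∂volume.restrict Ω, u x ∈ Set.Icc (a : ℝ) b → Dv x = H (u x) • Du x := by
    intro a b ha hb
    rcases le_or_gt (a : ℝ) b with hab | hab
    · have hsub := Icc_subset_openInterval ha hb
      obtain ⟨f, f', M, hf, hf', hM, heq⟩ := exists_hasDerivAt_extension hab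
        (fun s hs => hI.hasDerivAt_tilde s (hsub hs))
        (fun s hs => (hI.hasDerivAt s (hsub hs)).continuousAt.continuousWithinAt)
      filter_upwards [hv.ae_eq_of_eq (hu.comp hΩ hf hf' hM) hΩ] with x hx hxI
      rw [hx (heq _ hxI).1.symm, (heq _ hxI).2]
    · exact ae_of_all _ fun x hx => absurd (hx.1.trans hx.2) hab.not_ge
  have hall : ∀ᵐ x ∂volume.restrict Ω, ∀ a b : ℚ, (a : ℝ) ∈ openInterval B →
      (b : ℝ) ∈ openInterval B → u x ∈ Set.Icc (a : ℝ) b → Dv x = H (u x) • Du x := by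
    simp only [ae_all_iff]
    exact hIcc
  filter_upwards [hall, huI, hv.ae_eq_zero_of_eq hΩ (Ht 0),
    hv.ae_eq_zero_of_eq hΩ (Ht B.toReal)] with x hx hxI h0 hB
  refine ⟨fun hxJ => ?_, fun hxJ => ?_⟩
  · obtain ⟨a, b, ha, hb, h1, h2⟩ := exists_rat_mem_openInterval hxJ
    exact hx a b ha hb ⟨h1, h2⟩
  · rcases eq_zero_or_eq_toReal_of_mem_closedInterval (hI.subset_closedInterval hxI) hxJ with h | h
    · exact h0 (by rw [h])
    · exact hB (by rw [h])

/-! ### Measurability, Young's inequality and absorption. -/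

theorem aemeasurable_comp_of_continuousOn {α : Type*} [MeasurableSpace α] {ν : Measure α}
    {J : Set ℝ} (hJ : IsOpen J) {F : ℝ → ℝ} (hF : ContinuousOn F J) {u : α → ℝ}
    (hu : AEMeasurable u ν) (hmem : ∀ᵐ x ∂ν, u x ∈ J) : AEMeasurable (fun x => F (u x)) ν := by
  classical
  have h1 : Measurable (J.piecewise F 0) :=
    hF.measurable_piecewise continuousOn_const hJ.measurableSet
  refine (h1.comp_aemeasurable hu).congr ?_
  filter_upwards [hmem] with x hx
  simp [hx]

/-- Weighted Young inequality, applied with d = ‖∇u‖, y = H(u), q = h(u). -/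
theorem two_mul_le_mul_sq_add {c q : ℝ} (hc : 0 < c) (hq : 0 < q) (d y : ℝ) :
    2 * (d * |y|) ≤ c * (d ^ 2 * q) + c⁻¹ * (y ^ 2 / q) := by
  have hkey : c * (d ^ 2 * q) + c⁻¹ * (y ^ 2 / q) - 2 * (d * |y|) =
      (c * q * d - |y|) ^ 2 / (c * q) := by
    rw [← sq_abs y]
    field_simp
    ring
  have : 0 ≤ (c * q * d - |y|) ^ 2 / (c * q) := by positivity
  linarith

/-- Absorption: if `2 T ≤ c Y + c⁻¹ G` pointwise and `∫ G ≤ c ∫ T < ∞`, then `∫ T ≤ c ∫ Y`. -/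
theorem lintegral_le_of_two_mul_le {α : Type*} [MeasurableSpace α] {ν : Measure α} {c : ℝ}
    (hc : 0 < c) {G T Y : α → ℝ} (hG : Integrable G ν) (hT : Integrable T ν)
    (hG0 : ∀ᵐ x ∂ν, 0 ≤ G x) (hT0 : ∀ᵐ x ∂ν, 0 ≤ T x)
    (hle : ∀ᵐ x ∂ν, 2 * T x ≤ c * Y x + c⁻¹ * G x) (hint : ∫ x, G x ∂ν ≤ c * ∫ x, T x ∂ν) :
    ∫⁻ x, ENNReal.ofReal (T x) ∂ν ≤ ENNReal.ofReal c * ∫⁻ x, ENNReal.ofReal (Y x) ∂ν := by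
  have hTfin : ∫⁻ x, ENNReal.ofReal (T x) ∂ν ≠ ⊤ := by
    rw [← ofReal_integral_eq_lintegral_ofReal hT hT0]; exact ENNReal.ofReal_ne_top
  have hGT : ENNReal.ofReal c⁻¹ * ∫⁻ x, ENNReal.ofReal (G x) ∂ν ≤
      ∫⁻ x, ENNReal.ofReal (T x) ∂ν := by
    rw [← ofReal_integral_eq_lintegral_ofReal hT hT0, ← ofReal_integral_eq_lintegral_ofReal hG hG0,
      ← ENNReal.ofReal_mul (by positivity)]
    refine ENNReal.ofReal_le_ofReal ?_
    rwa [inv_mul_le_iff₀ hc]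
  have hTm : AEMeasurable (fun x => ENNReal.ofReal (T x)) ν := hT.aemeasurable.ennreal_ofReal
  have hGm : AEMeasurable (fun x => ENNReal.ofReal c⁻¹ * ENNReal.ofReal (G x)) ν :=
    hG.aemeasurable.ennreal_ofReal.const_mul _
  -- Finiteness of ∫ T permits cancelling one copy, while ∫ Y may be infinite.
  refine (ENNReal.add_le_add_iff_right hTfin).1 ?_
  calc ∫⁻ x, ENNReal.ofReal (T x) ∂ν + ∫⁻ x, ENNReal.ofReal (T x) ∂ν
      = ∫⁻ x, (ENNReal.ofReal (T x) + ENNReal.ofReal (T x)) ∂ν := (lintegral_add_left' hTm _).symm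
    _ ≤ ∫⁻ x, (ENNReal.ofReal c * ENNReal.ofReal (Y x) +
          ENNReal.ofReal c⁻¹ * ENNReal.ofReal (G x)) ∂ν := by
        refine lintegral_mono_ae ?_
        filter_upwards [hle, hT0] with x hx hx0
        rw [← ENNReal.ofReal_add hx0 hx0, ← two_mul, ← ENNReal.ofReal_mul hc.le,
          ← ENNReal.ofReal_mul (by positivity)]
        exact (ENNReal.ofReal_le_ofReal hx).trans ENNReal.ofReal_add_le
    _ = ENNReal.ofReal c * ∫⁻ x, ENNReal.ofReal (Y x) ∂ν +
          ENNReal.ofReal c⁻¹ * ∫⁻ x, ENNReal.ofReal (G x) ∂ν := by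
        rw [lintegral_add_right' _ hGm, lintegral_const_mul' _ _ ENNReal.ofReal_ne_top,
          lintegral_const_mul' _ _ ENNReal.ofReal_ne_top]
    _ ≤ _ := by gcongr

end OpialIneq

/-! ### The two inequalities. -/

theorem theorem4p3 {n : ℕ} (hn : 2 ≤ n) (Ω : Set (EuclideanSpace ℝ (Fin n)))
    (hΩ : OpialIneq.IsBoundedLipschitzDomain Ω)
    (B : EReal) (hB : 0 < B) (h H Ht : ℝ → ℝ) (I : Set ℝ)
    (hh : OpialIneq.IsPrincipalWeight B h)
    (hI : OpialIneq.IsAdmissibleInterval B h H Ht I)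
    (CH : ℝ) (hCH : 0 < CH)
    (hG : ∀ s ∈ OpialIneq.openInterval B, OpialIneq.transG H h s ≤ CH * |Ht s|)
    (u : EuclideanSpace ℝ (Fin n) → ℝ)
    (Du : EuclideanSpace ℝ (Fin n) → EuclideanSpace ℝ (Fin n))
    (hu : OpialIneq.HasWeakGradient Ω u Du)
    (huI : ∀ᵐ x ∂(volume.restrict Ω), u x ∈ I)
    (hW : OpialIneq.MemW01 Ω (fun x => Ht (u x))) :
    -- the integrals in the first inequality converge
    IntegrableOn (fun x => OpialIneq.transG H h (u x))
      (Ω ∩ u ⁻¹' OpialIneq.openInterval B) ∧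
    IntegrableOn (fun x => |OpialIneq.transT H h (u x)| ^ 2 * h (u x))
      (Ω ∩ u ⁻¹' OpialIneq.openInterval B) ∧
    IntegrableOn (fun x => ‖Du x‖ * |OpialIneq.transT H h (u x)| * h (u x))
      (Ω ∩ u ⁻¹' OpialIneq.openInterval B) ∧
    -- constants in the Poincaré inequality exist, and the inequalities hold for each of them
    (∃ CP : ℝ, OpialIneq.IsPoincareConstant Ω CP) ∧
    ∀ CP : ℝ, OpialIneq.IsPoincareConstant Ω CP →
      ((∫ x in Ω ∩ u ⁻¹' OpialIneq.openInterval B, OpialIneq.transG H h (u x)) =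
        ∫ x in Ω ∩ u ⁻¹' OpialIneq.openInterval B,
          |OpialIneq.transT H h (u x)| ^ 2 * h (u x)) ∧
      ((∫ x in Ω ∩ u ⁻¹' OpialIneq.openInterval B,
          |OpialIneq.transT H h (u x)| ^ 2 * h (u x)) ≤
        CP * CH * ∫ x in Ω ∩ u ⁻¹' OpialIneq.openInterval B,
          ‖Du x‖ * |OpialIneq.transT H h (u x)| * h (u x)) ∧
      -- here the right-hand side may be infinite
      ((∫⁻ x in Ω ∩ u ⁻¹' OpialIneq.openInterval B,
          ENNReal.ofReal (‖Du x‖ * |OpialIneq.transT H h (u x)| * h (u x))) ≤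
        ENNReal.ofReal (CP * CH) * ∫⁻ x in Ω ∩ u ⁻¹' OpialIneq.openInterval B,
          ENNReal.ofReal (‖Du x‖ ^ 2 * h (u x))) := by
  set J := OpialIneq.openInterval B
  have hΩo := hΩ.isOpen
  obtain ⟨Dv, hDv, hvi, hDvi, -⟩ := id hW
  have hgrad := OpialIneq.ae_weakGradient_comp_eq hI hΩo hu huI hDv
  have hJ : IsOpen J := OpialIneq.isOpen_openInterval B
  set μ := volume.restrict Ω with hμ
  have hum : AEMeasurable u μ := hu.locallyIntegrable.aestronglyMeasurable.aemeasurable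
  -- As u is only a.e. measurable, its preimages are only null-measurable.
  have hpre : NullMeasurableSet (u ⁻¹' J) μ := hum.nullMeasurableSet_preimage hJ.measurableSet
  have hν : volume.restrict (Ω ∩ u ⁻¹' J) = μ.restrict (u ⁻¹' J) := by
    rw [hμ, Measure.restrict_restrict₀ hpre, Set.inter_comm]
  have hνμ : μ.restrict (u ⁻¹' J) ≤ μ := Measure.restrict_le_self
  simp only [IntegrableOn, hν]
  set ν := μ.restrict (u ⁻¹' J)
  have hmem : ∀ᵐ x ∂ν, u x ∈ J := ae_restrict_mem₀ hpre
  have hgradν : ∀ᵐ x ∂ν, Dv x = H (u x) • Du x := by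
    filter_upwards [hmem, hνμ.absolutelyContinuous.ae_le hgrad] with x hx hg
    exact hg.1 hx
  have humν : AEMeasurable u ν := hum.mono_measure hνμ
  have hHc : ContinuousOn H J := fun s hs => (hI.hasDerivAt s hs).continuousAt.continuousWithinAt
  have hGc : ContinuousOn (OpialIneq.transG H h) J :=
    (hHc.pow 2).div hh.continuousOn fun s hs => (hh.pos s hs).ne'
  have hG0 : ∀ s ∈ J, 0 ≤ OpialIneq.transG H h s := fun s hs =>
    div_nonneg (sq_nonneg _) (hh.pos s hs).le
  have hGm : AEMeasurable (fun x => OpialIneq.transG H h (u x)) ν :=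
    OpialIneq.aemeasurable_comp_of_continuousOn hJ hGc humν hmem
  have hGi : Integrable (fun x => OpialIneq.transG H h (u x)) ν := by
    refine ((Integrable.mono_measure hvi hνμ).abs.const_mul CH).mono' hGm.aestronglyMeasurable ?_
    filter_upwards [hmem] with x hx
    rw [Real.norm_eq_abs, abs_of_nonneg (hG0 _ hx)]
    exact hG _ hx
  have hGT : (fun x => OpialIneq.transG H h (u x)) =ᵐ[ν]
      fun x => |OpialIneq.transT H h (u x)| ^ 2 * h (u x) := by
    filter_upwards [hmem] with x hx
    have := (hh.pos _ hx).ne'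
    rw [OpialIneq.transG, OpialIneq.transT, sq_abs]
    field_simp
  have hT : (fun x => ‖Du x‖ * |OpialIneq.transT H h (u x)| * h (u x)) =ᵐ[ν] fun x => ‖Dv x‖ := by
    filter_upwards [hmem, hgradν] with x hx hg
    have := hh.pos _ hx
    rw [hg, norm_smul, OpialIneq.transT, abs_div, abs_of_pos this, Real.norm_eq_abs]
    field_simp
  have hTi : Integrable (fun x => ‖Du x‖ * |OpialIneq.transT H h (u x)| * h (u x)) ν :=
    (Integrable.mono_measure hDvi hνμ).norm.congr hT.symm
  -- No gradient is lost by restricting to {u ∈ (0,B)}, so (P), which sees all of Ω, yields an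
  -- integral over this set only.
  have hDvν : ∫ x, ‖Du x‖ * |OpialIneq.transT H h (u x)| * h (u x) ∂ν = ∫ x, ‖Dv x‖ ∂μ := by
    rw [integral_congr_ae hT]
    refine setIntegral_eq_integral_of_ae_compl_eq_zero ?_
    filter_upwards [hgrad] with x hx hxJ
    rw [hx.2 hxJ, norm_zero]
  refine ⟨hGi, hGi.congr hGT, hTi, OpialIneq.exists_isPoincareConstant hn hΩo hΩ.isBounded,
    fun CP hCP => ?_⟩
  have hfirst : ∫ x, OpialIneq.transG H h (u x) ∂ν ≤
      CP * CH * ∫ x, ‖Du x‖ * |OpialIneq.transT H h (u x)| * h (u x) ∂ν := by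
    calc ∫ x, OpialIneq.transG H h (u x) ∂ν ≤ ∫ x, CH * |Ht (u x)| ∂ν := by
          refine integral_mono_ae hGi ((Integrable.mono_measure hvi hνμ).abs.const_mul CH) ?_
          filter_upwards [hmem] with x hx using hG _ hx
      _ ≤ ∫ x, CH * |Ht (u x)| ∂μ :=
          integral_mono_measure hνμ (ae_of_all _ fun x => by positivity)
            (Integrable.const_mul (Integrable.abs hvi) CH)
      _ = CH * ∫ x, |Ht (u x)| ∂μ := integral_const_mul _ _
      _ ≤ CH * (CP * ∫ x, ‖Dv x‖ ∂μ) := by gcongr; exact hCP.2 _ _ hW hDv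
      _ = _ := by rw [hDvν]; ring
  refine ⟨integral_congr_ae hGT, (integral_congr_ae hGT).symm.trans_le hfirst, ?_⟩
  -- The Young weight is the constant of the first inequality, so that c⁻¹ ∫ G is at most one copy
  -- of the middle integral.
  have hc : 0 < CP * CH := mul_pos hCP.1 hCH
  refine OpialIneq.lintegral_le_of_two_mul_le hc hGi hTi ?_ ?_ ?_ hfirst
  · filter_upwards [hmem] with x hx using hG0 _ hx
  · filter_upwards [hmem] with x hx
    have := hh.pos _ hx
    positivity
  · filter_upwards [hmem] with x hx
    have hp := hh.pos _ hx
    rw [OpialIneq.transG, OpialIneq.transT, abs_div, abs_of_pos hp, mul_assoc,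
      div_mul_cancel₀ _ hp.ne']
    exact OpialIneq.two_mul_le_mul_sq_add hc hp _ _
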